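/- Let $R$ be a unital ring; modules are left modules, and for a set $S$ let $\mathcal F(S)$ be the set of nonempty finite subsets of $S$; for a module $M$ let $\mathcal F^0(M)$ be the set of finite subsets of $M$ containing $0$. **Weak lengths.** An *$R$-weak length* $\ell$ assigns to every nonempty subset $A$ of an $R$-module a value $\ell(A)\in\mathbb R\cup\{+\infty\}$ such that: $\ell(\{0\})=0$; $\ell(A\times B)=\ell(A)+\ell(B)$ for nonempty subsets $A\subseteq M$, $B\subseteq N$ of $R$-modules; $\ell(\varphi(A))\le\ell(A)$ for every $R$-homomorphism $\varphi:M\to N$ and nonempty $A\subseteq M$; and if nonempty sets $A_n$ ($n\in\mathbb N$) increase to $A$, then $\ell(A_n)$ increases to $\ell(A)$. (Such values are automatically nonnegative.) It is *locally finite* if $\ell(A)<+\infty$ for all nonempty finite $A$, and has the *strong quotient property* if $\ell(A+B)\ge\ell(\varphi(A))+\ell(B)$ for every $R$-homomorphism $\varphi:M\to N$, $A\in\mathcal F^0(M)$ and $B\in\mathcal F^0(\ker\varphi)$. **Bivariant weak lengths.** A *bivariant $R$-weak length function* assigns to nonempty subsets $A,B$ of a common $R$-module a value $\ell(A,B)\in\mathbb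 R\cup\{+\infty\}$ such that: $\ell(\{0\},\{0\})=0$; $\ell(A\times A',B\times B')=\ell(A,B)+\ell(A',B')$; $\ell(\varphi(A),\varphi(B))\le\ell(A,B)$ for every $R$-homomorphism $\varphi$; if nonempty $A_n$ increase to $A$, then $\ell(A_n,B)$ increases to $\ell(A,B)$; and if $A$ is finite and nonempty sets $B_n$ decrease to a nonempty set $B$, then $\ell(A,B_n)$ converges to $\ell(A,B)$. It is a *proper upgrading* of $\ell$ if $\ell(A,\{0\})=\ell(A)$ for all nonempty $A$; $\ell(A,C)\le\ell(A,B)+\ell(B,C)$ for all $A,B,C\in\mathcal F(M)$; and for every $R$-homomorphism $\varphi:M\to N$, $A\in\mathcal F(M)$ and $\varepsilon>0$ there is $B\in\mathcal F(\ker\varphi)$ with $\ell(A,B)\le\ell(\varphi(A))+\varepsilon$. **Mean weak length.** Let $\Gamma$ be a discrete group. A set $F\in\mathcal F(\Gamma)$ is *$(K,\delta)$-invariant*, for $K\in\mathcal F(\Gamma)$ and $\delta>0$, if $|\{s\in F: Ks\subseteq F\}|\ge(1-\delta)|F|$; $\Gamma$ is *amenable* if $(K,\delta)$-invariant sets exist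 for all $K$ and $\delta$. We write $\lim_F f(F)=c$ if for every neighbourhood $U$ of $c$ there are $K\in\mathcal F(\Gamma)$ and $\delta>0$ with $f(F)\in U$ for all $(K,\delta)$-invariant $F\in\mathcal F(\Gamma)$. For an $R\Gamma$-module $M$ (also regarded as an $R$-module by restriction of scalars) and $A\in\mathcal F^0(M)$ put $A^{[F]}=\sum_{s\in F}s^{-1}A$ and $$\mathrm m\ell(A)=\lim_F\frac{\ell(A^{[F]})}{|F|},\qquad \mathrm m\ell(M)=\sup_{A\in\mathcal F^0(M)}\mathrm m\ell(A)\in[0,+\infty].$$ **Theorem.** Let $R$ be a unital ring, $\Gamma$ a discrete amenable group and $\ell$ a locally finite $R$-weak length with the strong quotient property. If $\ell$ has a proper upgrading to a bivariant $R$-weak length function, then all the limits $\mathrm m\ell(A)$ above exist and are finite, and for all $R\Gamma$-modules $M_1\subseteq M_2$, $$\mathrm m\ell(M_2)=\mathrm m\ell(M_1)+\mathrm m\ell(M_2/M_1).$$ -/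

import Mathlib

open Filter Topology
open scoped Pointwise ENNReal NNReal

universe u v w

/-- An `R`-weak length: a function on nonempty subsets of `R`-modules with values in `ℝ ∪ {+∞}`.
The values are automatically nonnegative (map `M` onto the zero module and use `regular` and
`quotient`), so they are taken in `ℝ≥0∞`.  The value on the empty set carries no meaning and is
never used. -/
structure WeakLength (R : Type u) [Ring R] where
  /-- The value of the weak length on a subset of an `R`-module. -/
  length : ∀ {M : Type v} [AddCommGroup M] [Module R M], Set M → ℝ≥0∞
  /-- Regularity. -/
  regular : ∀ (M : Type v) [AddCommGroup M] [Module R M], length ({0} : Set M) = 0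
  /-- Product property. -/
  product : ∀ {M N : Type v} [AddCommGroup M] [Module R M] [AddCommGroup N] [Module R N]
    (A : Set M) (B : Set N), A.Nonempty → B.Nonempty →
    length (A ×ˢ B) = length A + length B
  /-- Quotient property. -/
  quotient : ∀ {M N : Type v} [AddCommGroup M] [Module R M] [AddCommGroup N] [Module R N]
    (φ : M →ₗ[R] N) (A : Set M), A.Nonempty → length (φ '' A) ≤ length A
  /-- Upper continuity: if `A n` increases to `⋃ n, A n`, then `length (A n)` increases to
  `length (⋃ n, A n)`. -/
  upper_continuous : ∀ {M : Type v} [AddCommGroup M] [Module R M] (A : ℕ → Set M),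
    (∀ n, (A n).Nonempty) → Monotone A →
    Monotone (fun n => length (A n)) ∧
      Tendsto (fun n => length (A n)) atTop (𝓝 (length (⋃ n, A n)))

/-- `ℓ` is finite on nonempty finite subsets of `R`-modules. -/
def WeakLength.LocallyFinite {R : Type u} [Ring R] (ℓ : WeakLength.{u, v} R) : Prop :=
  ∀ (M : Type v) [AddCommGroup M] [Module R M] (A : Set M),
    A.Finite → A.Nonempty → ℓ.length A < ∞

/-- The strong quotient property: `ℓ(φ(A)) + ℓ(B) ≤ ℓ(A + B)` for finite sets `A ⊆ M` and
`B ⊆ ker φ` containing zero. -/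
def WeakLength.StrongQuotient {R : Type u} [Ring R] (ℓ : WeakLength.{u, v} R) : Prop :=
  ∀ (M N : Type v) [AddCommGroup M] [Module R M] [AddCommGroup N] [Module R N]
    (φ : M →ₗ[R] N) (A B : Set M), A.Finite → 0 ∈ A → B.Finite → 0 ∈ B →
    B ⊆ (LinearMap.ker φ : Set M) →
    ℓ.length (φ '' A) + ℓ.length B ≤ ℓ.length (A + B)

/-- A bivariant `R`-weak length function: a function of pairs of nonempty subsets of a common
`R`-module with values in `ℝ ∪ {+∞}` (again automatically nonnegative). -/
structure BivariantWeakLength (R : Type u) [Ring R] where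
  /-- The value on a pair of subsets of an `R`-module. -/
  length : ∀ {M : Type v} [AddCommGroup M] [Module R M], Set M → Set M → ℝ≥0∞
  /-- Regularity. -/
  regular : ∀ (M : Type v) [AddCommGroup M] [Module R M],
    length ({0} : Set M) ({0} : Set M) = 0
  /-- Direct product property. -/
  product : ∀ {M N : Type v} [AddCommGroup M] [Module R M] [AddCommGroup N] [Module R N]
    (A B : Set M) (A' B' : Set N), A.Nonempty → B.Nonempty → A'.Nonempty → B'.Nonempty →
    length (A ×ˢ A') (B ×ˢ B') = length A B + length A' B'
  /-- Quotient property. -/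
  quotient : ∀ {M N : Type v} [AddCommGroup M] [Module R M] [AddCommGroup N] [Module R N]
    (φ : M →ₗ[R] N) (A B : Set M), A.Nonempty → B.Nonempty →
    length (φ '' A) (φ '' B) ≤ length A B
  /-- Continuity in the first variable along increasing sequences. -/
  continuous_left : ∀ {M : Type v} [AddCommGroup M] [Module R M] (A : ℕ → Set M) (B : Set M),
    (∀ n, (A n).Nonempty) → B.Nonempty → Monotone A →
    Monotone (fun n => length (A n) B) ∧
      Tendsto (fun n => length (A n) B) atTop (𝓝 (length (⋃ n, A n) B))
  /-- Continuity in the second variable along decreasing sequences, for a finite first variable.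
  Only the convergence of the values is required, not a direction of monotonicity. -/
  continuous_right : ∀ {M : Type v} [AddCommGroup M] [Module R M] (A : Set M) (B : ℕ → Set M),
    A.Finite → A.Nonempty → (⋂ n, B n).Nonempty → Antitone B →
    Tendsto (fun n => length A (B n)) atTop (𝓝 (length A (⋂ n, B n)))

/-- The bivariant weak length `b` is an upgrading of `ℓ`: `b(A, {0}) = ℓ(A)`. -/
def BivariantWeakLength.IsUpgrading {R : Type u} [Ring R] (b : BivariantWeakLength.{u, v} R)
    (ℓ : WeakLength.{u, v} R) : Prop :=
  ∀ (M : Type v) [AddCommGroup M] [Module R M] (A : Set M), A.Nonempty →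
    b.length A {0} = ℓ.length A

/-- The bivariant weak length `b` is a proper upgrading of `ℓ`. -/
structure BivariantWeakLength.IsProperUpgrading {R : Type u} [Ring R]
    (b : BivariantWeakLength.{u, v} R) (ℓ : WeakLength.{u, v} R) : Prop where
  upgrading : b.IsUpgrading ℓ
  triangle : ∀ (M : Type v) [AddCommGroup M] [Module R M] (A B C : Set M),
    A.Finite → A.Nonempty → B.Finite → B.Nonempty → C.Finite → C.Nonempty →
    b.length A C ≤ b.length A B + b.length B C
  approx : ∀ (M N : Type v) [AddCommGroup M] [Module R M] [AddCommGroup N] [Module R N]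
    (φ : M →ₗ[R] N) (A : Set M), A.Finite → A.Nonempty → ∀ ε : ℝ, 0 < ε →
    ∃ B : Set M, B.Finite ∧ B.Nonempty ∧ B ⊆ (LinearMap.ker φ : Set M) ∧
      b.length A B ≤ ℓ.length (φ '' A) + ENNReal.ofReal ε

/-- The finite set `F` is `(K, δ)`-invariant: `|{s ∈ F : K s ⊆ F}| ≥ (1 - δ) |F|`. -/
def IsInvariantFinset {Γ : Type w} [Group Γ] (K : Finset Γ) (δ : ℝ) (F : Finset Γ) : Prop :=
  (1 - δ) * (F.card : ℝ) ≤ (Set.ncard {s : Γ | s ∈ F ∧ ∀ k ∈ K, k * s ∈ F} : ℝ)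

/-- The discrete group `Γ` is amenable: for all nonempty finite `K` and `δ > 0` there is a nonempty
finite `(K, δ)`-invariant set. -/
def IsAmenableGroup (Γ : Type w) [Group Γ] : Prop :=
  ∀ (K : Finset Γ) (δ : ℝ), K.Nonempty → 0 < δ →
    ∃ F : Finset Γ, F.Nonempty ∧ IsInvariantFinset K δ F

/-- The filter expressing that the nonempty finite set `F ⊆ Γ` gets more and more left invariant:
it is generated by the sets of nonempty `(K, δ)`-invariant finite subsets. -/
def invariantFilter (Γ : Type w) [Group Γ] : Filter (Finset Γ) :=
  ⨅ (K : Finset Γ) (_ : K.Nonempty) (δ : ℝ) (_ : 0 < δ),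
    𝓟 {F : Finset Γ | F.Nonempty ∧ IsInvariantFinset K δ F}

/-- `A^{[F]} = ∑_{s ∈ F} s⁻¹ A` for a subset `A` of an `RΓ`-module (a sum of sets). -/
def bracketSum (R : Type u) [Ring R] {Γ : Type w} [Group Γ] {M : Type v} [AddCommGroup M]
    [Module (MonoidAlgebra R Γ) M] (A : Set M) (F : Finset Γ) : Set M :=
  ∑ s ∈ F, (fun x : M => MonoidAlgebra.of R Γ s⁻¹ • x) '' A

namespace WeakLength

variable {R : Type u} [Ring R] (ℓ : WeakLength.{u, v} R) (Γ : Type w) [Group Γ]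

/-! In what follows an `RΓ`-module `M` is regarded as an `R`-module by restriction of scalars along
`R → RΓ`; this is what `IsScalarTower R (MonoidAlgebra R Γ) M` says. -/

/-- The averaged value `ℓ(A^{[F]}) / |F|`. -/
noncomputable def average {M : Type v} [AddCommGroup M] [Module R M] [Module (MonoidAlgebra R Γ) M]
    [IsScalarTower R (MonoidAlgebra R Γ) M] (A : Set M) (F : Finset Γ) : ℝ≥0∞ :=
  ℓ.length (bracketSum R A F) / (F.card : ℝ≥0∞)

/-- `mℓ(A) = lim_F ℓ(A^{[F]}) / |F|`, the limit being taken as `F` gets more and more left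
invariant. -/
noncomputable def meanSet {M : Type v} [AddCommGroup M] [Module R M] [Module (MonoidAlgebra R Γ) M]
    [IsScalarTower R (MonoidAlgebra R Γ) M] (A : Set M) : ℝ≥0∞ :=
  limUnder (invariantFilter Γ) (ℓ.average Γ A)

/-- The mean weak length of an `RΓ`-module `M`: the supremum of `mℓ(A)` over the finite subsets `A`
of `M` containing zero. -/
noncomputable def mean (M : Type v) [AddCommGroup M] [Module R M] [Module (MonoidAlgebra R Γ) M]
    [IsScalarTower R (MonoidAlgebra R Γ) M] : ℝ≥0∞ :=
  ⨆ (A : Finset M) (_ : (0 : M) ∈ A), ℓ.meanSet Γ (A : Set M)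

end WeakLength

/-! The engine is quasi-tiling: finitely many shapes `S`, chosen among sets with a prescribed
property, cover every sufficiently invariant `F` by right translates, up to a small error and a
small overlap. Since `A^{[St]} = t⁻¹ A^{[S]}`, a translate costs no more than its shape, so
subadditivity bounds `ℓ(A^{[F]})` by the costs of the tiles. Tiling by shapes whose average is near
the liminf gives limsup ≤ liminf (`exists_tendsto_average`); the averages never exceed `ℓ(A)`, so
the limit is finite. In the addition formula, `≥` comes from applying the strong quotient property
to bracket sums and passing to the limit (`meanSet_image_add_meanSet_le`). For `≤`
(`meanSet_le_meanSet_image_add`), let `φ` be the quotient map. The upgrading gives each shape `S` a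
finite `B S ⊆ ker φ` with `b(A^{[S]}, B S)` at most slightly above `ℓ(φ(A)^{[S]})`. Translates of
the `B S` add up to a set `X` with `b(A^{[F]}, X)` at most about `mℓ(φ(A))|F|`, and `X ⊆ D^{[F]}`
for one finite `D ⊆ ker φ` independent of `F`. The triangle inequality through `X` finishes. -/

section Invariance

/-! ### Invariant sets and quasi-tilings of amenable groups. -/

variable {Γ : Type w} [Group Γ]

theorem IsInvariantFinset.mono {K K' F : Finset Γ} {δ δ' : ℝ} (hK : K' ⊆ K) (hδ : δ ≤ δ')
    (h : IsInvariantFinset K δ F) : IsInvariantFinset K' δ' F := by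
  unfold IsInvariantFinset at *
  have h1 : Set.ncard {s : Γ | s ∈ F ∧ ∀ k ∈ K, k * s ∈ F} ≤
      Set.ncard {s : Γ | s ∈ F ∧ ∀ k ∈ K', k * s ∈ F} :=
    Set.ncard_le_ncard (fun s hs => ⟨hs.1, fun k hk => hs.2 k (hK hk)⟩)
      (F.finite_toSet.subset fun s hs => hs.1)
  have h2 : (Set.ncard {s : Γ | s ∈ F ∧ ∀ k ∈ K, k * s ∈ F} : ℝ) ≤
      Set.ncard {s : Γ | s ∈ F ∧ ∀ k ∈ K', k * s ∈ F} := by exact_mod_cast h1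
  nlinarith [(Nat.cast_nonneg F.card : (0 : ℝ) ≤ F.card)]

theorem mem_invariantFilter {s : Set (Finset Γ)} :
    s ∈ invariantFilter Γ ↔ ∃ (K : Finset Γ) (δ : ℝ), K.Nonempty ∧ 0 < δ ∧
      ∀ F : Finset Γ, F.Nonempty → IsInvariantFinset K δ F → F ∈ s := by
  classical
  have key : invariantFilter Γ = ⨅ p : {p : Finset Γ × ℝ // p.1.Nonempty ∧ 0 < p.2},
      𝓟 {F : Finset Γ | F.Nonempty ∧ IsInvariantFinset p.1.1 p.1.2 F} := by
    simp only [invariantFilter, iInf_subtype, iInf_prod, iInf_and]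
    refine iInf_congr fun K => ?_
    rw [iInf_comm]
  have : Nonempty {p : Finset Γ × ℝ // p.1.Nonempty ∧ 0 < p.2} :=
    ⟨⟨({1}, 1), Finset.singleton_nonempty _, one_pos⟩⟩
  rw [key, mem_iInf_of_directed]
  · simp only [mem_principal, Subtype.exists, Prod.exists]
    constructor
    · rintro ⟨K, δ, ⟨hK, hδ⟩, h⟩
      exact ⟨K, δ, hK, hδ, fun F hF hi => h ⟨hF, hi⟩⟩
    · rintro ⟨K, δ, hK, hδ, h⟩
      exact ⟨K, δ, ⟨hK, hδ⟩, fun F hF => h F hF.1 hF.2⟩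
  · rintro ⟨⟨K, δ⟩, hK, hδ⟩ ⟨⟨K', δ'⟩, hK', hδ'⟩
    refine ⟨⟨(K ∪ K', min δ δ'), hK.mono Finset.subset_union_left, lt_min hδ hδ'⟩, ?_, ?_⟩
    · exact principal_mono.2 fun F hF =>
        ⟨hF.1, hF.2.mono Finset.subset_union_left (min_le_left _ _)⟩
    · exact principal_mono.2 fun F hF =>
        ⟨hF.1, hF.2.mono Finset.subset_union_right (min_le_right _ _)⟩

theorem eventually_nonempty_invariantFilter : ∀ᶠ F in invariantFilter Γ, F.Nonempty :=
  mem_invariantFilter.2 ⟨{1}, 1, Finset.singleton_nonempty _, one_pos, fun _ hF _ => hF⟩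

theorem IsAmenableGroup.neBot (h : IsAmenableGroup Γ) : (invariantFilter Γ).NeBot := by
  refine ⟨fun hbot => ?_⟩
  have h0 : (∅ : Set (Finset Γ)) ∈ invariantFilter Γ := hbot ▸ mem_bot
  obtain ⟨K, δ, hK, hδ, hF⟩ := mem_invariantFilter.1 h0
  obtain ⟨F, hne, hinv⟩ := h K δ hK hδ
  exact hF F hne hinv

theorem Filter.Frequently.exists_isInvariantFinset {p : Finset Γ → Prop}
    (hp : ∃ᶠ F in invariantFilter Γ, p F) {K : Finset Γ} {δ : ℝ} (hK : K.Nonempty) (hδ : 0 < δ) :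
    ∃ F, p F ∧ F.Nonempty ∧ IsInvariantFinset K δ F := by
  have h : ∀ᶠ F in invariantFilter Γ, F.Nonempty ∧ IsInvariantFinset K δ F :=
    mem_invariantFilter.2 ⟨K, δ, hK, hδ, fun F hF hi => ⟨hF, hi⟩⟩
  exact (hp.and_eventually h).exists

variable [DecidableEq Γ]

theorem IsInvariantFinset.card_filter_le {K F : Finset Γ} {δ : ℝ} (h : IsInvariantFinset K δ F) :
    (1 - δ) * (F.card : ℝ) ≤ ((F.filter fun s => ∀ k ∈ K, k * s ∈ F).card : ℝ) := by
  rwa [← Set.ncard_coe_finset (Finset.filter _ _), Finset.coe_filter]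

theorem isInvariantFinset_iff_card_filter_le {K F : Finset Γ} {δ : ℝ} :
    IsInvariantFinset K δ F ↔
      ((F.filter fun s => ¬ ∀ k ∈ K, k * s ∈ F).card : ℝ) ≤ δ * (F.card : ℝ) := by
  have h := Finset.card_filter_add_card_filter_not (s := F) (fun s => ∀ k ∈ K, k * s ∈ F)
  have h' : ((F.filter fun s => ∀ k ∈ K, k * s ∈ F).card : ℝ) +
      ((F.filter fun s => ¬ ∀ k ∈ K, k * s ∈ F).card : ℝ) = F.card := by exact_mod_cast h
  have h2 : IsInvariantFinset K δ F ↔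
      (1 - δ) * (F.card : ℝ) ≤ ((F.filter fun s => ∀ k ∈ K, k * s ∈ F).card : ℝ) := by
    rw [← Set.ncard_coe_finset (Finset.filter _ _), Finset.coe_filter, IsInvariantFinset]
  rw [h2]
  constructor <;> intro <;> linarith

/-- A maximal `ε`-disjoint family of right translates of `S` inside `F` covers at least the
proportion `ε` of the points `s` with `S s ⊆ F`. -/
theorem exists_almost_disjoint_translates {S : Finset Γ} (hS : S.Nonempty) (F : Finset Γ)
    {ε : ℝ} (hε : ε ≤ 1) :
    ∃ T ⊆ F.filter fun s => ∀ k ∈ S, k * s ∈ F,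
      (1 - ε) * (T.card * S.card : ℝ) ≤ ((T.biUnion fun t => S.image (· * t)).card : ℝ) ∧
      ε * ((F.filter fun s => ∀ k ∈ S, k * s ∈ F).card : ℝ) ≤
        ((T.biUnion fun t => S.image (· * t)).card : ℝ) := by
  set G := F.filter fun s => ∀ k ∈ S, k * s ∈ F with hG
  let P := G.powerset.filter fun T =>
    (1 - ε) * (T.card * S.card : ℝ) ≤ ((T.biUnion fun t => S.image (· * t)).card : ℝ)
  obtain ⟨T, hT, hmax⟩ := P.exists_max_image Finset.card ⟨∅, by simp [P]⟩
  simp only [P, Finset.mem_filter, Finset.mem_powerset] at hT hmax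
  refine ⟨T, hT.1, hT.2, ?_⟩
  set U := T.biUnion fun t => S.image (· * t) with hU
  have hSpos : (0 : ℝ) < S.card := by exact_mod_cast hS.card_pos
  have hcardimg : ∀ s, (S.image (· * s)).card = S.card := fun s =>
    Finset.card_image_of_injective _ (mul_left_injective s)
  -- Otherwise `S s` has more than `(1 - ε)|S|` points outside `U`, and adding `s` to `T`
  -- contradicts maximality.
  have hmeet : ∀ s ∈ G, ε * (S.card : ℝ) ≤ ((S.filter fun k => k * s ∈ U).card : ℝ) := by
    intro s hs
    by_contra! hlt
    have hsplit : ((S.image (· * s)) \ U).card + (S.filter fun k => k * s ∈ U).card = S.card := by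
      have h1 : (S.image (· * s)) \ U = (S.filter fun k => ¬ k * s ∈ U).image (· * s) := by
        ext x; simp only [Finset.mem_sdiff, Finset.mem_image, Finset.mem_filter]; aesop
      rw [h1, Finset.card_image_of_injective _ (mul_left_injective s), add_comm,
        Finset.card_filter_add_card_filter_not]
    have hsplit' : (((S.image (· * s)) \ U).card : ℝ) +
        ((S.filter fun k => k * s ∈ U).card : ℝ) = S.card := by exact_mod_cast hsplit
    have hbig : (1 - ε) * (S.card : ℝ) < (((S.image (· * s)) \ U).card : ℝ) := by linarith
    have hsT : s ∉ T := by
      intro hsT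
      have : (S.image (· * s)) \ U = ∅ :=
        Finset.sdiff_eq_empty_iff_subset.2 (Finset.subset_biUnion_of_mem (fun t => S.image (· * t)) hsT)
      rw [this, Finset.card_empty, Nat.cast_zero] at hbig
      nlinarith
    have hc := hmax (insert s T) ⟨Finset.insert_subset hs hT.1, by
      rw [Finset.biUnion_insert, Finset.card_insert_of_notMem hsT, ← Finset.sdiff_union_self_eq_union,
        Finset.card_union_of_disjoint Finset.sdiff_disjoint]
      push_cast
      nlinarith [hT.2]⟩
    rw [Finset.card_insert_of_notMem hsT] at hc
    omega
  -- Double counting of pairs `(k, s)` with `k * s ∈ U`: for fixed `k`, the map `s ↦ k * s` is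
  -- injective.
  have hcount : ∑ s ∈ G, (S.filter fun k => k * s ∈ U).card ≤ S.card * U.card := by
    simp only [Finset.card_filter]
    rw [Finset.sum_comm]
    calc ∑ k ∈ S, ∑ s ∈ G, (if k * s ∈ U then 1 else 0)
        ≤ ∑ _k ∈ S, U.card := by
          refine Finset.sum_le_sum fun k _ => ?_
          rw [← Finset.card_filter]
          exact Finset.card_le_card_of_injOn (fun s => k * s)
            (fun s hs => (Finset.mem_filter.1 hs).2) ((mul_right_injective k).injOn)
      _ = S.card * U.card := by simp
  have hcount' : ∑ s ∈ G, ((S.filter fun k => k * s ∈ U).card : ℝ) ≤ S.card * U.card := by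
    exact_mod_cast hcount
  have hlow : (G.card : ℝ) * (ε * S.card) ≤ ∑ s ∈ G, ((S.filter fun k => k * s ∈ U).card : ℝ) := by
    simpa using Finset.card_nsmul_le_sum G _ _ hmeet
  nlinarith

/-- Removing an almost disjoint union of translates of an invariant set from an invariant set
leaves a set that is not much less invariant. -/
theorem card_filter_sdiff_biUnion_le (K S T F : Finset Γ) :
    ((F \ T.biUnion fun t => S.image (· * t)).filter fun s =>
        ¬ ∀ k ∈ K, k * s ∈ F \ T.biUnion fun t => S.image (· * t)).card ≤
      (F.filter fun s => ¬ ∀ k ∈ K, k * s ∈ F).card +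
        K.card * (S.filter fun s => ¬ ∀ k ∈ K⁻¹, k * s ∈ S).card * T.card := by
  set U := T.biUnion fun t => S.image (· * t) with hU
  set D := S.filter fun s => ¬ ∀ k ∈ K⁻¹, k * s ∈ S
  -- If `k * s` stays in `F` but enters `U`, then `k * s = σ * t`, and `s ∉ U` forces `k⁻¹ * σ ∉ S`.
  -- So `σ` is in the `K⁻¹`-boundary of `S`, and `(k, σ, t)` determines `s`.
  have hsub : ((F \ U).filter fun s => ¬ ∀ k ∈ K, k * s ∈ F \ U) ⊆
      (F.filter fun s => ¬ ∀ k ∈ K, k * s ∈ F) ∪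
        ((K ×ˢ D) ×ˢ T).image fun p => p.1.1⁻¹ * p.1.2 * p.2 := by
    intro s hs
    simp only [Finset.mem_filter, Finset.mem_sdiff, not_forall] at hs
    obtain ⟨⟨hsF, hsU⟩, k, hk, hks⟩ := hs
    rw [Finset.mem_union]
    by_cases hkF : k * s ∈ F
    · right
      have hkU : k * s ∈ U := by tauto
      simp only [hU, Finset.mem_biUnion, Finset.mem_image] at hkU hsU
      obtain ⟨t, ht, σ, hσ, he⟩ := hkU
      have hs' : k⁻¹ * σ * t = s := by rw [mul_assoc, he, inv_mul_cancel_left]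
      refine Finset.mem_image.2 ⟨((k, σ), t), ?_, hs'⟩
      simp only [Finset.mem_product, D, Finset.mem_filter, not_forall]
      exact ⟨⟨hk, hσ, k⁻¹, Finset.inv_mem_inv hk, fun h => hsU ⟨t, ht, k⁻¹ * σ, h, hs'⟩⟩, ht⟩
    · left
      simp only [Finset.mem_filter, not_forall]
      exact ⟨hsF, k, hk, hkF⟩
  calc _ ≤ _ := Finset.card_le_card hsub
    _ ≤ _ := Finset.card_union_le _ _
    _ ≤ _ := by
      gcongr
      refine Finset.card_image_le.trans ?_
      simp only [Finset.card_product]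
      rfl


/-- Each induction step adds one shape `S`, placed before the older ones and so invariant that what
it leaves of `F` still satisfies the invariance they need. At least half the points `s` of `F` have
`S s ⊆ F`, so the new translates cover at least `ε / 2` of `F`. -/
theorem exists_quasiTiling_aux {p : Finset Γ → Prop} (hp : ∃ᶠ S in invariantFilter Γ, p S) {ε : ℝ}
    (hε : 0 < ε) (hε1 : ε < 1) (n : ℕ) :
    ∃ 𝒮 : Finset (Finset Γ), (∀ S ∈ 𝒮, S.Nonempty ∧ p S) ∧
      ∃ (K : Finset Γ) (δ : ℝ), K.Nonempty ∧ 0 < δ ∧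
        ∀ F : Finset Γ, F.Nonempty → IsInvariantFinset K δ F →
          ∃ T : Finset (Finset Γ × Γ), (∀ q ∈ T, q.1 ∈ 𝒮 ∧ ∀ s ∈ q.1, s * q.2 ∈ F) ∧
            (1 - ε) * (∑ q ∈ T, (q.1.card : ℝ)) ≤
              ((T.biUnion fun q => q.1.image (· * q.2)).card : ℝ) ∧
            ((F \ T.biUnion fun q => q.1.image (· * q.2)).card : ℝ) ≤
              max ε ((1 - ε / 2) ^ n) * (F.card : ℝ) := by
  induction n with
  | zero =>
    refine ⟨∅, by simp, {1}, 1, by simp, one_pos, fun F _ _ => ⟨∅, by simp, by simp, ?_⟩⟩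
    simp only [Finset.biUnion_empty, Finset.sdiff_empty, pow_zero]
    exact le_mul_of_one_le_left (Nat.cast_nonneg _) (le_max_right _ _)
  | succ n ih =>
    obtain ⟨𝒮, h𝒮, K, δ, hK, hδ, hT⟩ := ih
    have hKpos : (0 : ℝ) < K.card := by exact_mod_cast hK.card_pos
    have h1ε : 0 < 1 - ε := by linarith
    -- With `(1 - ε)|T₀||S| ≤ |F|`, this `η` bounds the boundary created by the translates by `(ε δ
    -- / 2)|F|`; the invariance of `F` supplies the other half of `ε δ |F|`.
    set η : ℝ := ε * δ * (1 - ε) / (2 * K.card) with hη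
    have hηpos : 0 < η := by positivity
    have hηK : K.card * η = ε * δ / 2 * (1 - ε) := by rw [hη]; field_simp
    obtain ⟨S, hpS, hS, hSinv⟩ := hp.exists_isInvariantFinset hK.inv hηpos
    rw [isInvariantFinset_iff_card_filter_le] at hSinv
    refine ⟨insert S 𝒮, ?_, K ∪ S, min (1 / 2) (ε * δ / 2), hK.mono Finset.subset_union_left,
      by positivity, fun F hF hinv => ?_⟩
    · intro S' hS'
      rcases Finset.mem_insert.1 hS' with rfl | h
      exacts [⟨hS, hpS⟩, h𝒮 _ h]
    have hFK := isInvariantFinset_iff_card_filter_le.1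
      (hinv.mono (K' := K) Finset.subset_union_left (min_le_right _ _))
    have hFS := (hinv.mono (K' := S) Finset.subset_union_right (min_le_left _ _)).card_filter_le
    obtain ⟨T₀, hT₀, hdisj, hcov⟩ := exists_almost_disjoint_translates hS F hε1.le
    have hdef := card_filter_sdiff_biUnion_le K S T₀ F
    set U := T₀.biUnion fun t => S.image (· * t) with hU
    have hUF : U ⊆ F := by
      intro x hx
      simp only [hU, Finset.mem_biUnion, Finset.mem_image] at hx
      obtain ⟨t, ht, σ, hσ, rfl⟩ := hx
      exact (Finset.mem_filter.1 (hT₀ ht)).2 σ hσ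
    have hcard : ((F \ U).card : ℝ) + U.card = F.card := by
      exact_mod_cast Finset.card_sdiff_add_card_eq_card hUF
    have hFpos : (0 : ℝ) < F.card := by exact_mod_cast hF.card_pos
    have hrem : ((F \ U).card : ℝ) ≤ (1 - ε / 2) * F.card := by nlinarith
    have hTU : ((T₀.image fun t => (S, t)).biUnion fun q => q.1.image (· * q.2)) = U := by
      rw [Finset.image_biUnion]
    have hTsum : ∑ q ∈ T₀.image (fun t => (S, t)), (q.1.card : ℝ) = T₀.card * S.card := by
      rw [Finset.sum_image (fun a _ b _ h => (Prod.ext_iff.1 h).2)]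
      simp
    have hTmem : ∀ q ∈ T₀.image (fun t => (S, t)),
        q.1 ∈ insert S 𝒮 ∧ ∀ s ∈ q.1, s * q.2 ∈ F := by
      intro q hq
      obtain ⟨t, ht, rfl⟩ := Finset.mem_image.1 hq
      exact ⟨Finset.mem_insert_self _ _, (Finset.mem_filter.1 (hT₀ ht)).2⟩
    -- A remainder below `ε |F|` is already acceptable. Above it, a boundary of size `ε δ |F|` is
    -- less than `δ |F \ U|`, so the remainder is `(K, δ)`-invariant.
    by_cases hsmall : ((F \ U).card : ℝ) ≤ ε * F.card
    · refine ⟨T₀.image fun t => (S, t), hTmem, ?_, ?_⟩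
      · rw [hTU, hTsum]; exact hdisj
      · rw [hTU]
        exact hsmall.trans (by gcongr; exact le_max_left _ _)
    push Not at hsmall
    have hne : (F \ U).Nonempty := by
      rw [← Finset.card_pos]
      have : (0 : ℝ) < (F \ U).card := lt_of_le_of_lt (by positivity) hsmall
      exact_mod_cast this
    have hinv' : IsInvariantFinset K δ (F \ U) := by
      rw [isInvariantFinset_iff_card_filter_le]
      have hdef' : (((F \ U).filter fun s => ¬ ∀ k ∈ K, k * s ∈ F \ U).card : ℝ) ≤
          ((F.filter fun s => ¬ ∀ k ∈ K, k * s ∈ F).card : ℝ) +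
          K.card * ((S.filter fun s => ¬ ∀ k ∈ K⁻¹, k * s ∈ S).card : ℝ) * T₀.card := by
        exact_mod_cast hdef
      have hUF' : (U.card : ℝ) ≤ F.card := by exact_mod_cast Finset.card_le_card hUF
      have h1 : K.card * ((S.filter fun s => ¬ ∀ k ∈ K⁻¹, k * s ∈ S).card : ℝ) * T₀.card ≤
          ε * δ / 2 * F.card := by
        calc K.card * ((S.filter fun s => ¬ ∀ k ∈ K⁻¹, k * s ∈ S).card : ℝ) * T₀.card
            ≤ K.card * (η * S.card) * T₀.card := by gcongr
          _ = ε * δ / 2 * ((1 - ε) * (T₀.card * S.card)) := by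
              rw [← mul_assoc, hηK]; ring
          _ ≤ ε * δ / 2 * F.card := by gcongr; exact hdisj.trans hUF'
      nlinarith
    obtain ⟨T₁, hT₁, hdisj₁, hrem₁⟩ := hT _ hne hinv'
    set U₁ := T₁.biUnion fun q => q.1.image (· * q.2) with hU₁
    have hU₁F : U₁ ⊆ F \ U := by
      intro x hx
      simp only [hU₁, Finset.mem_biUnion, Finset.mem_image] at hx
      obtain ⟨q, hq, σ, hσ, rfl⟩ := hx
      exact (hT₁ q hq).2 σ hσ
    have hunion : ((T₀.image fun t => (S, t)) ∪ T₁).biUnion (fun q => q.1.image (· * q.2)) =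
        U ∪ U₁ := by rw [Finset.union_biUnion, hTU]
    refine ⟨(T₀.image fun t => (S, t)) ∪ T₁, ?_, ?_, ?_⟩
    · intro q hq
      rcases Finset.mem_union.1 hq with h | h
      · exact hTmem q h
      · exact ⟨Finset.mem_insert_of_mem (hT₁ q h).1,
          fun s hs => (Finset.mem_sdiff.1 ((hT₁ q h).2 s hs)).1⟩
    · rw [hunion, Finset.card_union_of_disjoint
        (Finset.disjoint_sdiff.mono_right hU₁F)]
      have h2 : ∑ q ∈ T₀.image (fun t => (S, t)) ∪ T₁, (q.1.card : ℝ) ≤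
          T₀.card * S.card + ∑ q ∈ T₁, (q.1.card : ℝ) := by
        rw [← hTsum, ← Finset.sum_union_inter]
        exact le_add_of_nonneg_right (Finset.sum_nonneg fun _ _ => Nat.cast_nonneg _)
      push_cast
      nlinarith
    · rw [hunion, ← Finset.sup_eq_union, ← sdiff_sdiff_left]
      refine hrem₁.trans ?_
      rcases le_total ε ((1 - ε / 2) ^ n) with h | h
      · rw [max_eq_right h]
        calc (1 - ε / 2) ^ n * ((F \ U).card : ℝ) ≤ (1 - ε / 2) ^ n * ((1 - ε / 2) * F.card) := by
              gcongr
              exact hε.le.trans h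
          _ = (1 - ε / 2) ^ (n + 1) * F.card := by ring
          _ ≤ _ := by gcongr; exact le_max_right _ _
      · rw [max_eq_left h]
        gcongr
        · exact le_max_left _ _
        · exact Finset.sdiff_subset

/-- Quasi-tilings (Ornstein and Weiss): if sets with the property `p` occur arbitrarily far along
the invariant filter, then finitely many of them suffice to quasi-tile, by right translates, all
sufficiently invariant sets up to an arbitrarily small proportion. -/
theorem exists_quasiTiling {p : Finset Γ → Prop} (hp : ∃ᶠ S in invariantFilter Γ, p S) {ε : ℝ}
    (hε : 0 < ε) :
    ∃ 𝒮 : Finset (Finset Γ), (∀ S ∈ 𝒮, S.Nonempty ∧ p S) ∧ ∀ᶠ F in invariantFilter Γ,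
      ∃ (T : Finset (Finset Γ × Γ)) (E : Finset Γ), (∀ q ∈ T, q.1 ∈ 𝒮 ∧ ∀ s ∈ q.1, s * q.2 ∈ F) ∧
        F ⊆ (T.biUnion fun q => q.1.image (· * q.2)) ∪ E ∧
        ∑ q ∈ T, (q.1.card : ℝ) ≤ (1 + ε) * F.card ∧ (E.card : ℝ) ≤ ε * F.card := by
  -- `ε' ≤ 1 / 2` gives `(1 + 2ε')(1 - ε') ≥ 1`, which turns almost disjointness into total tile
  -- size at most `(1 + ε)|F|`.
  set ε' := min ε 1 / 2 with hε'
  have h0 : 0 < ε' := by positivity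
  have h1 : ε' ≤ 1 / 2 := by rw [hε']; gcongr; exact min_le_right _ _
  have h2 : ε' ≤ ε / 2 := by rw [hε']; gcongr; exact min_le_left _ _
  obtain ⟨n, hn⟩ := exists_pow_lt_of_lt_one h0 (show 1 - ε' / 2 < 1 by linarith)
  obtain ⟨𝒮, h𝒮, K, δ, hK, hδ, h⟩ := exists_quasiTiling_aux hp h0 (by linarith) n
  refine ⟨𝒮, h𝒮, mem_invariantFilter.2 ⟨K, δ, hK, hδ, fun F hF hinv => ?_⟩⟩
  obtain ⟨T, hT, hsum, hrem⟩ := h F hF hinv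
  refine ⟨T, _, hT, sdiff_le_iff.1 le_rfl, ?_, ?_⟩
  · have hle : ((T.biUnion fun q => q.1.image (· * q.2)).card : ℝ) ≤ F.card := by
      refine Nat.cast_le.2 (Finset.card_le_card fun x hx => ?_)
      simp only [Finset.mem_biUnion, Finset.mem_image] at hx
      obtain ⟨q, hq, σ, hσ, rfl⟩ := hx
      exact (hT q hq).2 σ hσ
    have hs : 0 ≤ ∑ q ∈ T, (q.1.card : ℝ) := Finset.sum_nonneg fun _ _ => Nat.cast_nonneg _
    have hm : ∑ q ∈ T, (q.1.card : ℝ) ≤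
        (1 + 2 * ε') * ((1 - ε') * ∑ q ∈ T, (q.1.card : ℝ)) := by
      nlinarith [mul_nonneg (mul_nonneg h0.le (by linarith : 0 ≤ 1 - 2 * ε')) hs]
    calc ∑ q ∈ T, (q.1.card : ℝ) ≤ (1 + 2 * ε') * ((1 - ε') * ∑ q ∈ T, (q.1.card : ℝ)) := hm
      _ ≤ (1 + 2 * ε') * F.card := by gcongr; exact hsum.trans hle
      _ ≤ (1 + ε) * F.card := by gcongr; linarith
  · rw [max_eq_left hn.le] at hrem
    exact hrem.trans (by gcongr; linarith)

end Invariance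

/-! ### Finite sums of sets. -/

section FinsetSum

variable {α ι : Type*} [AddCommMonoid α] {s t : Finset ι} {A : ι → Set α}

theorem Set.nonempty_finsetSum (hA : ∀ i ∈ s, (A i).Nonempty) : (∑ i ∈ s, A i).Nonempty := by
  choose! g hg using hA
  exact ⟨_, Set.finsetSum_mem_finsetSum s A g hg⟩

theorem Set.zero_mem_finsetSum (hA : ∀ i ∈ s, 0 ∈ A i) : 0 ∈ ∑ i ∈ s, A i := by
  simpa using Set.finsetSum_mem_finsetSum s A (fun _ => 0) hA

theorem Set.finite_finsetSum (hA : ∀ i ∈ s, (A i).Finite) : (∑ i ∈ s, A i).Finite := by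
  classical
  induction s using Finset.induction_on with
  | empty => simp
  | insert i s hi ih =>
    rw [Finset.sum_insert hi]
    exact (hA i (Finset.mem_insert_self _ _)).add
      (ih fun j hj => hA j (Finset.mem_insert_of_mem hj))

theorem Set.finsetSum_subset_coe {σ : Type*} [SetLike σ α] [AddSubmonoidClass σ α] (p : σ)
    (hA : ∀ i ∈ s, A i ⊆ p) : ∑ i ∈ s, A i ⊆ p := by
  intro x hx
  obtain ⟨g, hg, rfl⟩ := (Set.mem_finsetSum s A x).1 hx
  exact sum_mem fun i hi => hA i hi (hg hi)

theorem Set.finsetSum_subset_of_subset (hst : s ⊆ t) (hA : ∀ i ∈ t, 0 ∈ A i) :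
    ∑ i ∈ s, A i ⊆ ∑ i ∈ t, A i := by
  classical
  rw [← Finset.sum_sdiff hst]
  exact Set.subset_add_right _
    (Set.zero_mem_finsetSum fun i hi => hA i (Finset.sdiff_subset hi))

end FinsetSum

/-! ### Monotonicity and subadditivity of weak lengths and their bivariant versions. -/

namespace WeakLength

variable {R : Type u} [Ring R] (ℓ : WeakLength.{u, v} R) {M : Type v} [AddCommGroup M] [Module R M]

/-- Upper continuity applied to the sequence `A, B, B, …`. -/
theorem mono {A B : Set M} (hA : A.Nonempty) (h : A ⊆ B) : ℓ.length A ≤ ℓ.length B := by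
  have hm : Monotone fun n : ℕ => if n = 0 then A else B :=
    monotone_nat_of_le_succ fun n => by rcases n with _ | n <;> simp [h]
  have := (ℓ.upper_continuous (fun n : ℕ => if n = 0 then A else B)
    (fun n => by rcases n with _ | n <;> simp [hA, hA.mono h]) hm).1 (zero_le_one)
  simpa using this

/-- Addition `M × M → M` is linear and maps `A × B` onto `A + B`. -/
theorem add_le {A B : Set M} (hA : A.Nonempty) (hB : B.Nonempty) :
    ℓ.length (A + B) ≤ ℓ.length A + ℓ.length B := by
  rw [← ℓ.product A B hA hB]
  have h := ℓ.quotient (LinearMap.fst R M M + LinearMap.snd R M M) (A ×ˢ B) (hA.prod hB)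
  have he : (LinearMap.fst R M M + LinearMap.snd R M M) '' (A ×ˢ B) = A + B := by
    rw [← Set.add_image_prod]; rfl
  rwa [he] at h

theorem sum_le {ι : Type*} (s : Finset ι) (A : ι → Set M) (hA : ∀ i ∈ s, (A i).Nonempty) :
    ℓ.length (∑ i ∈ s, A i) ≤ ∑ i ∈ s, ℓ.length (A i) := by
  classical
  induction s using Finset.induction_on with
  | empty => simp [← Set.singleton_zero, ℓ.regular]
  | insert i s hi ih =>
    rw [Finset.sum_insert hi, Finset.sum_insert hi]
    have hs : ∀ j ∈ s, (A j).Nonempty := fun j hj => hA j (Finset.mem_insert_of_mem hj)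
    exact (ℓ.add_le (hA i (Finset.mem_insert_self _ _)) (Set.nonempty_finsetSum hs)).trans
      (add_le_add_right (ih hs) _)

end WeakLength

namespace BivariantWeakLength

variable {R : Type u} [Ring R] (b : BivariantWeakLength.{u, v} R) {M : Type v} [AddCommGroup M]
  [Module R M]

theorem mono_left {A A' B : Set M} (hA : A.Nonempty) (hB : B.Nonempty) (h : A ⊆ A') :
    b.length A B ≤ b.length A' B := by
  have hm : Monotone fun n : ℕ => if n = 0 then A else A' :=
    monotone_nat_of_le_succ fun n => by rcases n with _ | n <;> simp [h]
  have := (b.continuous_left (fun n : ℕ => if n = 0 then A else A') B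
    (fun n => by rcases n with _ | n <;> simp [hA, hA.mono h]) hB hm).1 (zero_le_one)
  simpa using this

theorem add_le {A B A' B' : Set M} (hA : A.Nonempty) (hB : B.Nonempty) (hA' : A'.Nonempty)
    (hB' : B'.Nonempty) :
    b.length (A + A') (B + B') ≤ b.length A B + b.length A' B' := by
  rw [← b.product A B A' B' hA hB hA' hB']
  have h := b.quotient (LinearMap.fst R M M + LinearMap.snd R M M) (A ×ˢ A') (B ×ˢ B')
    (hA.prod hA') (hB.prod hB')
  have he : ∀ C D : Set M,
      (LinearMap.fst R M M + LinearMap.snd R M M) '' (C ×ˢ D) = C + D := fun C D => by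
    rw [← Set.add_image_prod]; rfl
  rwa [he, he] at h

theorem sum_le {ι : Type*} (s : Finset ι) (A B : ι → Set M) (hA : ∀ i ∈ s, (A i).Nonempty)
    (hB : ∀ i ∈ s, (B i).Nonempty) :
    b.length (∑ i ∈ s, A i) (∑ i ∈ s, B i) ≤ ∑ i ∈ s, b.length (A i) (B i) := by
  classical
  induction s using Finset.induction_on with
  | empty => simp [← Set.singleton_zero, b.regular]
  | insert i s hi ih =>
    rw [Finset.sum_insert hi, Finset.sum_insert hi, Finset.sum_insert hi]
    have hs : ∀ j ∈ s, (A j).Nonempty := fun j hj => hA j (Finset.mem_insert_of_mem hj)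
    have hs' : ∀ j ∈ s, (B j).Nonempty := fun j hj => hB j (Finset.mem_insert_of_mem hj)
    exact (b.add_le (hA i (Finset.mem_insert_self _ _)) (hB i (Finset.mem_insert_self _ _))
      (Set.nonempty_finsetSum hs) (Set.nonempty_finsetSum hs')).trans
      (add_le_add_right (ih hs hs') _)

/-- A weak length with a proper upgrading does not depend on the ambient module. -/
theorem IsProperUpgrading.length_image_of_injective {b : BivariantWeakLength.{u, v} R}
    {ℓ : WeakLength.{u, v} R} (hb : b.IsProperUpgrading ℓ) {N : Type v} [AddCommGroup N]
    [Module R N] (φ : M →ₗ[R] N) (hφ : Function.Injective φ) {A : Set M} (hA : A.Finite)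
    (hne : A.Nonempty) : ℓ.length (φ '' A) = ℓ.length A := by
  refine le_antisymm (ℓ.quotient φ A hne) (ENNReal.le_of_forall_pos_le_add fun ε hε _ => ?_)
  obtain ⟨B, -, hBne, hBker, hB⟩ := hb.approx M N φ A hA hne ε (by exact_mod_cast hε)
  have hB0 : B = {0} := by
    rw [LinearMap.ker_eq_bot.2 hφ] at hBker
    exact hBne.subset_singleton_iff.1 hBker
  rwa [hB0, hb.upgrading M A hne, ENNReal.ofReal_coe_nnreal] at hB

end BivariantWeakLength

/-! ### Bracket sums and the group action. -/

section BracketSum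

variable {R : Type u} [Ring R] {Γ : Type w} [Group Γ] {M : Type v} [AddCommGroup M]
  [Module (MonoidAlgebra R Γ) M] {A : Set M}

theorem finite_bracketSum (hA : A.Finite) (F : Finset Γ) : (bracketSum R A F).Finite :=
  Set.finite_finsetSum fun _ _ => hA.image _

theorem zero_mem_bracketSum (hA : 0 ∈ A) (F : Finset Γ) : 0 ∈ bracketSum R A F :=
  Set.zero_mem_finsetSum fun _ _ => ⟨0, hA, smul_zero _⟩

theorem bracketSum_mono {E F : Finset Γ} (hEF : E ⊆ F) (hA : 0 ∈ A) :
    bracketSum R A E ⊆ bracketSum R A F :=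
  Set.finsetSum_subset_of_subset hEF fun _ _ => ⟨0, hA, smul_zero _⟩

theorem bracketSum_union [DecidableEq Γ] (E F : Finset Γ) (hA : 0 ∈ A) :
    bracketSum R A (E ∪ F) ⊆ bracketSum R A E + bracketSum R A F := by
  rw [← Finset.union_sdiff_self_eq_union, bracketSum, Finset.sum_union Finset.disjoint_sdiff]
  exact Set.add_subset_add_left (bracketSum_mono Finset.sdiff_subset hA)

theorem bracketSum_biUnion [DecidableEq Γ] {ι : Type*} (T : Finset ι) (E : ι → Finset Γ)
    (hA : 0 ∈ A) : bracketSum R A (T.biUnion E) ⊆ ∑ i ∈ T, bracketSum R A (E i) := by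
  classical
  induction T using Finset.induction_on with
  | empty => simp [bracketSum]
  | insert i T hi ih =>
    rw [Finset.biUnion_insert, Finset.sum_insert hi]
    exact (bracketSum_union _ _ hA).trans (Set.add_subset_add_left ih)

theorem image_bracketSum {N : Type v} [AddCommGroup N] [Module (MonoidAlgebra R Γ) N]
    (φ : M →ₗ[MonoidAlgebra R Γ] N) (A : Set M) (F : Finset Γ) :
    φ '' bracketSum R A F = bracketSum R (φ '' A) F := by
  rw [bracketSum, bracketSum, Set.image_finsetSum]
  refine Finset.sum_congr rfl fun s _ => ?_
  simp only [Set.image_image, map_smul]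

end BracketSum

section GroupAction

variable (R : Type u) [Ring R] {Γ : Type w} [Group Γ] {M : Type v} [AddCommGroup M] [Module R M]
  [Module (MonoidAlgebra R Γ) M] [IsScalarTower R (MonoidAlgebra R Γ) M]

/-- The action of a group element on an `RΓ`-module, as an `R`-linear map. -/
noncomputable def groupAction (M : Type v) [AddCommGroup M] [Module R M]
    [Module (MonoidAlgebra R Γ) M] [IsScalarTower R (MonoidAlgebra R Γ) M] (s : Γ) : M →ₗ[R] M where
  toFun x := MonoidAlgebra.of R Γ s • x
  map_add' := smul_add _
  map_smul' r x := by
    -- Group elements commute with `R` inside `RΓ`; this is what makes the action `R`-linear.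
    have h : MonoidAlgebra.of R Γ s * (r • (1 : MonoidAlgebra R Γ)) =
        r • MonoidAlgebra.of R Γ s := by
      simp [MonoidAlgebra.one_def, MonoidAlgebra.single_mul_single]
    rw [RingHom.id_apply, ← smul_assoc r, ← h, mul_smul, smul_assoc, one_smul]

theorem groupAction_mul_apply (s t : Γ) (x : M) :
    groupAction R M (s * t) x = groupAction R M s (groupAction R M t x) := by
  simp only [groupAction, LinearMap.coe_mk, AddHom.coe_mk, map_mul, mul_smul]

theorem bracketSum_eq (A : Set M) (F : Finset Γ) :
    bracketSum R A F = ∑ s ∈ F, groupAction R M s⁻¹ '' A := rfl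

variable {R} {A : Set M}

/-- The reason for tiling by right translates: `(s * t)⁻¹ = t⁻¹ * s⁻¹` moves `t` outside the sum. -/
theorem bracketSum_image_mul_right [DecidableEq Γ] (A : Set M) (S : Finset Γ) (t : Γ) :
    bracketSum R A (S.image (· * t)) = groupAction R M t⁻¹ '' bracketSum R A S := by
  rw [bracketSum_eq, bracketSum_eq, Finset.sum_image (mul_left_injective t).injOn,
    Set.image_finsetSum]
  refine Finset.sum_congr rfl fun s _ => ?_
  rw [Set.image_image]
  refine Set.image_congr fun x _ => ?_
  rw [mul_inv_rev, groupAction_mul_apply]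

theorem bracketSum_add (A B : Set M) (F : Finset Γ) :
    bracketSum R (A + B) F = bracketSum R A F + bracketSum R B F := by
  simp only [bracketSum_eq, Set.image_add, Finset.sum_add_distrib]

theorem bracketSum_finsetSum {ι : Type*} (s : Finset ι) (A : ι → Set M) (F : Finset Γ) :
    bracketSum R (∑ i ∈ s, A i) F = ∑ i ∈ s, bracketSum R (A i) F := by
  simp only [bracketSum_eq, Set.image_finsetSum]
  rw [Finset.sum_comm]

theorem WeakLength.length_bracketSum_le (ℓ : WeakLength.{u, v} R) (hA : A.Nonempty)
    (F : Finset Γ) : ℓ.length (bracketSum R A F) ≤ F.card * ℓ.length A := by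
  rw [bracketSum_eq, ← nsmul_eq_mul]
  exact (ℓ.sum_le _ _ fun s _ => hA.image _).trans
    (Finset.sum_le_card_nsmul _ _ _ fun s _ => ℓ.quotient _ _ hA)

end GroupAction

/-! ### Bracket sums along a quasi-tiling. -/

section Covering

variable {R : Type u} [Ring R] {Γ : Type w} [Group Γ] [DecidableEq Γ] {M : Type v}
  [AddCommGroup M] [Module R M] [Module (MonoidAlgebra R Γ) M]
  [IsScalarTower R (MonoidAlgebra R Γ) M] {A : Set M}

/-- Overlaps of tiles are harmless because `0 ∈ A`: surplus summands can be taken to be zero. -/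
theorem bracketSum_subset_of_cover (hA : 0 ∈ A) {F E : Finset Γ} {T : Finset (Finset Γ × Γ)}
    (hF : F ⊆ (T.biUnion fun q => q.1.image (· * q.2)) ∪ E) :
    bracketSum R A F ⊆
      (∑ q ∈ T, groupAction R M q.2⁻¹ '' bracketSum R A q.1) + bracketSum R A E := by
  simp only [← bracketSum_image_mul_right]
  exact (bracketSum_mono hF hA).trans ((bracketSum_union _ _ hA).trans
    (Set.add_subset_add_right (bracketSum_biUnion _ _ hA)))

theorem WeakLength.length_bracketSum_le_of_cover (ℓ : WeakLength.{u, v} R) (hA : 0 ∈ A)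
    {F E : Finset Γ} {T : Finset (Finset Γ × Γ)}
    (hF : F ⊆ (T.biUnion fun q => q.1.image (· * q.2)) ∪ E) :
    ℓ.length (bracketSum R A F) ≤
      ∑ q ∈ T, ℓ.length (bracketSum R A q.1) + E.card * ℓ.length A := by
  have h0 : ∀ S : Finset Γ, (bracketSum R A S).Nonempty := fun S => ⟨0, zero_mem_bracketSum hA S⟩
  have hT : ∀ q ∈ T, (groupAction R M q.2⁻¹ '' bracketSum R A q.1).Nonempty :=
    fun q _ => (h0 _).image _
  calc ℓ.length (bracketSum R A F)
      ≤ ℓ.length ((∑ q ∈ T, groupAction R M q.2⁻¹ '' bracketSum R A q.1) + bracketSum R A E) :=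
        ℓ.mono (h0 F) (bracketSum_subset_of_cover hA hF)
    _ ≤ ℓ.length (∑ q ∈ T, groupAction R M q.2⁻¹ '' bracketSum R A q.1) +
          ℓ.length (bracketSum R A E) := ℓ.add_le (Set.nonempty_finsetSum hT) (h0 E)
    _ ≤ _ := by
        gcongr
        · exact (ℓ.sum_le _ _ hT).trans (Finset.sum_le_sum fun q _ => ℓ.quotient _ _ (h0 _))
        · exact ℓ.length_bracketSum_le ⟨0, hA⟩ E

theorem BivariantWeakLength.length_bracketSum_le_of_cover {b : BivariantWeakLength.{u, v} R}
    {ℓ : WeakLength.{u, v} R} (hb : b.IsUpgrading ℓ) (hA : 0 ∈ A)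
    {F E : Finset Γ} {T : Finset (Finset Γ × Γ)}
    (hF : F ⊆ (T.biUnion fun q => q.1.image (· * q.2)) ∪ E)
    {B : Finset Γ → Set M} (hB : ∀ S, (B S).Nonempty) :
    b.length (bracketSum R A F) (∑ q ∈ T, groupAction R M q.2⁻¹ '' B q.1) ≤
      ∑ q ∈ T, b.length (bracketSum R A q.1) (B q.1) + E.card * ℓ.length A := by
  have h0 : ∀ S : Finset Γ, (bracketSum R A S).Nonempty := fun S => ⟨0, zero_mem_bracketSum hA S⟩
  have hT : ∀ q ∈ T, (groupAction R M q.2⁻¹ '' bracketSum R A q.1).Nonempty :=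
    fun q _ => (h0 _).image _
  have hT' : ∀ q ∈ T, (groupAction R M q.2⁻¹ '' B q.1).Nonempty := fun q _ => (hB _).image _
  calc b.length (bracketSum R A F) (∑ q ∈ T, groupAction R M q.2⁻¹ '' B q.1)
      ≤ b.length ((∑ q ∈ T, groupAction R M q.2⁻¹ '' bracketSum R A q.1) + bracketSum R A E)
          (∑ q ∈ T, groupAction R M q.2⁻¹ '' B q.1) :=
        b.mono_left (h0 F) (Set.nonempty_finsetSum hT') (bracketSum_subset_of_cover hA hF)
    _ ≤ b.length (∑ q ∈ T, groupAction R M q.2⁻¹ '' bracketSum R A q.1)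
          (∑ q ∈ T, groupAction R M q.2⁻¹ '' B q.1) + b.length (bracketSum R A E) {0} := by
        simpa using b.add_le (Set.nonempty_finsetSum hT) (Set.nonempty_finsetSum hT') (h0 E)
          (Set.singleton_nonempty (0 : M))
    _ ≤ _ := by
        gcongr
        · exact (b.sum_le _ _ _ hT hT').trans
            (Finset.sum_le_sum fun q _ => b.quotient _ _ _ (h0 _) (hB _))
        · rw [hb M _ (h0 E)]
          exact ℓ.length_bracketSum_le ⟨0, hA⟩ E

/-- A sum of translates of the sets `B S` along tiles contained in `F` lies in a bracket sum over
`F`, once the `B S` are moved to a point `σ S` of the tile. -/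
theorem sum_image_subset_bracketSum {𝒮 : Finset (Finset Γ)} {F : Finset Γ}
    {T : Finset (Finset Γ × Γ)} {σ : Finset Γ → Γ}
    (hT : ∀ q ∈ T, q.1 ∈ 𝒮 ∧ σ q.1 * q.2 ∈ F) (B : Finset Γ → Set M) :
    ∑ q ∈ T, groupAction R M q.2⁻¹ '' B q.1 ⊆
      bracketSum R (∑ S ∈ 𝒮, insert 0 (groupAction R M (σ S) '' B S)) F := by
  set B' : Finset Γ → Set M := fun S => insert 0 (groupAction R M (σ S) '' B S)
  have h0 : ∀ S (t : Γ), (0 : M) ∈ groupAction R M t⁻¹ '' B' S :=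
    fun S t => ⟨0, Set.mem_insert _ _, map_zero _⟩
  -- Tiles are reindexed by shape and base point; inserting `0` in each `B' S` then lets the sum
  -- grow to all of `𝒮 ×ˢ F`.
  have hinj : Set.InjOn (fun q : Finset Γ × Γ => (q.1, σ q.1 * q.2)) T := by
    rintro ⟨S, s⟩ _ ⟨S', s'⟩ _ h
    simp only [Prod.mk.injEq] at h
    obtain ⟨rfl, h⟩ := h
    rw [mul_left_cancel h]
  calc ∑ q ∈ T, groupAction R M q.2⁻¹ '' B q.1
      ⊆ ∑ q ∈ T, groupAction R M (σ q.1 * q.2)⁻¹ '' B' q.1 := by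
        refine Set.finsetSum_subset_finsetSum _ _ _ fun q _ => ?_
        rintro _ ⟨x, hx, rfl⟩
        refine ⟨groupAction R M (σ q.1) x, Or.inr ⟨x, hx, rfl⟩, ?_⟩
        rw [← groupAction_mul_apply, mul_inv_rev, inv_mul_cancel_right]
    _ = ∑ p ∈ T.image (fun q => (q.1, σ q.1 * q.2)), groupAction R M p.2⁻¹ '' B' p.1 := by
        rw [Finset.sum_image hinj]
    _ ⊆ ∑ p ∈ 𝒮 ×ˢ F, groupAction R M p.2⁻¹ '' B' p.1 := by
        refine Set.finsetSum_subset_of_subset (fun p hp => ?_) fun p _ => h0 _ _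
        obtain ⟨q, hq, rfl⟩ := Finset.mem_image.1 hp
        exact Finset.mem_product.2 (hT q hq)
    _ = bracketSum R (∑ S ∈ 𝒮, B' S) F := by
        rw [Finset.sum_product, bracketSum_finsetSum]
        rfl

end Covering

/-! ### Estimates in `ℝ≥0∞`. -/

theorem ENNReal.le_of_forall_pos_le_add_ofReal_mul {x a D : ℝ≥0∞} (hD : D ≠ ∞)
    (h : ∀ ε : ℝ, 0 < ε → x ≤ a + ENNReal.ofReal ε * D) : x ≤ a := by
  have h1 : Tendsto (fun ε : ℝ => a + ENNReal.ofReal ε * D) (𝓝[>] 0) (𝓝 (a + 0 * D)) := by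
    refine tendsto_const_nhds.add (ENNReal.Tendsto.mul_const ?_ (Or.inr hD))
    simpa using (ENNReal.tendsto_ofReal (tendsto_id (α := ℝ) (x := 𝓝 0))).mono_left
      (nhdsWithin_le_nhds (s := Set.Ioi 0))
  rw [zero_mul, add_zero] at h1
  exact ge_of_tendsto h1 (eventually_mem_nhdsWithin.mono fun ε hε => h ε hε)

theorem ENNReal.sum_tiles_le {Γ : Type w} {g : Finset Γ → ℝ≥0∞} {c C : ℝ≥0∞} {ε : ℝ} (hε : 0 < ε)
    {F E : Finset Γ} {T : Finset (Finset Γ × Γ)} (hg : ∀ q ∈ T, g q.1 ≤ c * q.1.card)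
    (hT : ∑ q ∈ T, (q.1.card : ℝ) ≤ (1 + ε) * F.card) (hE : (E.card : ℝ) ≤ ε * F.card) :
    ∑ q ∈ T, g q.1 + E.card * C ≤ (c + ENNReal.ofReal ε * (c + C)) * F.card := by
  have hcast : ∀ n : ℕ, (n : ℝ≥0∞) = ENNReal.ofReal n := fun n => by simp
  have hT' : ∑ q ∈ T, (q.1.card : ℝ≥0∞) ≤ (1 + ENNReal.ofReal ε) * F.card := by
    have h1 : ∑ q ∈ T, (q.1.card : ℝ≥0∞) = ENNReal.ofReal (∑ q ∈ T, (q.1.card : ℝ)) := by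
      rw [ENNReal.ofReal_sum_of_nonneg fun _ _ => Nat.cast_nonneg _]
      simp
    rw [h1, hcast, ← ENNReal.ofReal_one, ← ENNReal.ofReal_add zero_le_one hε.le,
      ← ENNReal.ofReal_mul (by positivity)]
    exact ENNReal.ofReal_le_ofReal hT
  have hE' : (E.card : ℝ≥0∞) ≤ ENNReal.ofReal ε * F.card := by
    rw [hcast, hcast, ← ENNReal.ofReal_mul hε.le]
    exact ENNReal.ofReal_le_ofReal hE
  calc ∑ q ∈ T, g q.1 + E.card * C
      ≤ c * ((1 + ENNReal.ofReal ε) * F.card) + ENNReal.ofReal ε * F.card * C := by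
        gcongr
        refine (Finset.sum_le_sum hg).trans ?_
        rw [← Finset.mul_sum]
        gcongr
    _ = _ := by ring

/-! ### Existence of the mean and the addition formula. -/

namespace WeakLength

variable {R : Type u} [Ring R] {ℓ : WeakLength.{u, v} R} {Γ : Type w} [Group Γ] {M : Type v}
  [AddCommGroup M] [Module R M] [Module (MonoidAlgebra R Γ) M]
  [IsScalarTower R (MonoidAlgebra R Γ) M] {A : Set M}

theorem average_le_iff {F : Finset Γ} (hF : F.Nonempty) {c : ℝ≥0∞} :
    ℓ.average Γ A F ≤ c ↔ ℓ.length (bracketSum R A F) ≤ c * F.card :=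
  ENNReal.div_le_iff (by simpa using hF.ne_empty) (ENNReal.natCast_ne_top _)

theorem length_bracketSum_eq {F : Finset Γ} (hF : F.Nonempty) :
    ℓ.length (bracketSum R A F) = ℓ.average Γ A F * F.card :=
  (ENNReal.div_mul_cancel (by simpa using hF.ne_empty) (ENNReal.natCast_ne_top _)).symm

/-- The Ornstein–Weiss lemma for the averages of a weak length. -/
theorem exists_tendsto_average (hΓ : IsAmenableGroup Γ) (hfin : ℓ.LocallyFinite) (hA : A.Finite)
    (h0 : 0 ∈ A) :
    ∃ c : ℝ≥0, Tendsto (ℓ.average Γ A) (invariantFilter Γ) (𝓝 (c : ℝ≥0∞)) := by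
  classical
  have := hΓ.neBot
  have hC : ℓ.length A ≠ ∞ := (hfin M A hA ⟨0, h0⟩).ne
  set u := ℓ.average Γ A
  set f := invariantFilter Γ
  have hbdd : limsup u f ≤ ℓ.length A := by
    refine limsup_le_of_le (h := ?_)
    filter_upwards [eventually_nonempty_invariantFilter] with F hF
    rw [average_le_iff hF, mul_comm]
    exact ℓ.length_bracketSum_le ⟨0, h0⟩ F
  -- For `c` above the liminf, averages below `c` occur frequently, so such sets can serve as tile
  -- shapes.
  have hle : limsup u f ≤ liminf u f := by
    refine le_of_forall_gt_imp_ge_of_dense fun c hc => ?_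
    rcases eq_or_ne c ∞ with rfl | hcT
    · exact le_top
    refine ENNReal.le_of_forall_pos_le_add_ofReal_mul (ENNReal.add_ne_top.2 ⟨hcT, hC⟩)
      fun ε hε => limsup_le_of_le (h := ?_)
    obtain ⟨𝒮, h𝒮, hev⟩ := exists_quasiTiling (frequently_lt_of_liminf_lt (h := hc)) hε
    filter_upwards [hev, eventually_nonempty_invariantFilter] with F ⟨T, E, hT, hcov, hs, hE⟩ hF
    rw [average_le_iff hF]
    refine (ℓ.length_bracketSum_le_of_cover h0 hcov).trans (ENNReal.sum_tiles_le
      (g := fun S => ℓ.length (bracketSum R A S)) hε (fun q hq => ?_) hs hE)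
    obtain ⟨hS, hlt⟩ := h𝒮 _ (hT q hq).1
    exact (average_le_iff hS).1 hlt.le
  refine ⟨(limsup u f).toNNReal, ?_⟩
  rw [ENNReal.coe_toNNReal (ne_top_of_le_ne_top hC hbdd)]
  exact tendsto_of_le_liminf_of_limsup_le hle le_rfl

theorem tendsto_average_meanSet (hΓ : IsAmenableGroup Γ) (hfin : ℓ.LocallyFinite)
    (hA : A.Finite) (h0 : 0 ∈ A) :
    Tendsto (ℓ.average Γ A) (invariantFilter Γ) (𝓝 (ℓ.meanSet Γ A)) := by
  obtain ⟨c, hc⟩ := exists_tendsto_average hΓ hfin hA h0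
  exact tendsto_nhds_limUnder ⟨_, hc⟩

theorem meanSet_le_mean (hA : A.Finite) (h0 : 0 ∈ A) : ℓ.meanSet Γ A ≤ ℓ.mean Γ M := by
  have h := le_iSup₂ (f := fun (A : Finset M) (_ : (0 : M) ∈ A) => ℓ.meanSet Γ (A : Set M))
    hA.toFinset (hA.mem_toFinset.2 h0)
  rw [hA.coe_toFinset] at h
  exact h

variable {N : Type v} [AddCommGroup N] [Module R N] [Module (MonoidAlgebra R Γ) N]
  [IsScalarTower R (MonoidAlgebra R Γ) N]

/-- Allows finite subsets of the submodule to be measured in the ambient module. -/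
theorem meanSet_image_of_injective {b : BivariantWeakLength.{u, v} R}
    (hb : b.IsProperUpgrading ℓ) (φ : M →ₗ[MonoidAlgebra R Γ] N) (hφ : Function.Injective φ)
    (hA : A.Finite) (h0 : 0 ∈ A) : ℓ.meanSet Γ (φ '' A) = ℓ.meanSet Γ A := by
  have h : ℓ.average Γ (φ '' A) = ℓ.average Γ A := by
    funext F
    rw [average, average, ← image_bracketSum]
    congr 1
    exact hb.length_image_of_injective (φ.restrictScalars R) hφ (finite_bracketSum hA F)
      ⟨0, zero_mem_bracketSum h0 F⟩
  rw [meanSet, meanSet, h]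

/-- Bracket sums commute with `+` and with `φ`, and `ker φ` is stable under `Γ`, so the strong
quotient property applies for each `F`. -/
theorem meanSet_image_add_meanSet_le (hΓ : IsAmenableGroup Γ) (hfin : ℓ.LocallyFinite)
    (hquot : ℓ.StrongQuotient) (φ : M →ₗ[MonoidAlgebra R Γ] N) {B : Set M} (hA : A.Finite)
    (hA0 : 0 ∈ A) (hB : B.Finite) (hB0 : 0 ∈ B) (hker : B ⊆ LinearMap.ker φ) :
    ℓ.meanSet Γ (φ '' A) + ℓ.meanSet Γ B ≤ ℓ.meanSet Γ (A + B) := by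
  have := hΓ.neBot
  refine le_of_tendsto_of_tendsto'
    ((tendsto_average_meanSet hΓ hfin (hA.image φ) ⟨0, hA0, map_zero φ⟩).add
      (tendsto_average_meanSet hΓ hfin hB hB0))
    (tendsto_average_meanSet hΓ hfin (hA.add hB) ⟨0, hA0, 0, hB0, add_zero 0⟩) fun F => ?_
  simp only [average]
  rw [← ENNReal.add_div, bracketSum_add, ← image_bracketSum]
  refine ENNReal.div_le_div_right ?_ _
  refine hquot M N (φ.restrictScalars R) _ _ (finite_bracketSum hA F) (zero_mem_bracketSum hA0 F)
    (finite_bracketSum hB F) (zero_mem_bracketSum hB0 F) ?_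
  refine Set.finsetSum_subset_coe (LinearMap.ker φ) ?_
  rintro s - _ ⟨x, hx, rfl⟩
  exact Submodule.smul_mem _ _ (hker hx)

theorem meanSet_le_meanSet_image_add {b : BivariantWeakLength.{u, v} R} (hΓ : IsAmenableGroup Γ)
    (hfin : ℓ.LocallyFinite) (hb : b.IsProperUpgrading ℓ) (φ : M →ₗ[MonoidAlgebra R Γ] N)
    (hA : A.Finite) (h0 : 0 ∈ A) {m : ℝ≥0∞}
    (hm : ∀ B : Set M, B.Finite → 0 ∈ B → B ⊆ LinearMap.ker φ → ℓ.meanSet Γ B ≤ m) :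
    ℓ.meanSet Γ A ≤ ℓ.meanSet Γ (φ '' A) + m := by
  classical
  have := hΓ.neBot
  have hC : ℓ.length A ≠ ∞ := (hfin M A hA ⟨0, h0⟩).ne
  have hlim := tendsto_average_meanSet hΓ hfin (hA.image φ) ⟨0, h0, map_zero φ⟩
  suffices h : ∀ c, ℓ.meanSet Γ (φ '' A) < c → ℓ.meanSet Γ A ≤ c + m from
    ENNReal.le_of_forall_pos_le_add fun ε hε hlt => by
      have hne : ℓ.meanSet Γ (φ '' A) ≠ ∞ := (ENNReal.add_lt_top.1 hlt).1.ne
      rw [add_right_comm]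
      exact h _ (ENNReal.lt_add_right hne (by exact_mod_cast hε.ne'))
  intro c hc
  rcases eq_or_ne c ∞ with rfl | hcT
  · simp
  refine ENNReal.le_of_forall_pos_le_add_ofReal_mul (ENNReal.add_ne_top.2 ⟨hcT, hC⟩)
    fun ε hε => ?_
  obtain ⟨𝒮, h𝒮, hev⟩ := exists_quasiTiling (hlim.eventually_lt_const hc).frequently hε
  have hB : ∀ S : Finset Γ, ∃ B : Set M, B.Finite ∧ B.Nonempty ∧ B ⊆ LinearMap.ker φ ∧
      (S ∈ 𝒮 → b.length (bracketSum R A S) B ≤ c * S.card) := by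
    intro S
    by_cases hS : S ∈ 𝒮
    · obtain ⟨hne, hlt⟩ := h𝒮 S hS
      have hlt' : ℓ.length (bracketSum R (φ '' A) S) < c * S.card := by
        rw [length_bracketSum_eq hne]
        exact ENNReal.mul_lt_mul_left (by simpa using hne.ne_empty) (ENNReal.natCast_ne_top _) hlt
      -- The gap `r` below `c * S.card` serves as the error allowed in `approx`.
      obtain ⟨r, hr, hlt''⟩ := ENNReal.lt_iff_exists_add_pos_lt.1 hlt'
      obtain ⟨B, hBf, hBne, hBker, hle⟩ := hb.approx M N (φ.restrictScalars R) _
        (finite_bracketSum (R := R) hA S) ⟨0, zero_mem_bracketSum h0 S⟩ r hr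
      refine ⟨B, hBf, hBne, hBker, fun _ => hle.trans ?_⟩
      rw [LinearMap.coe_restrictScalars, image_bracketSum, ENNReal.ofReal_coe_nnreal]
      exact hlt''.le
    · exact ⟨{0}, Set.finite_singleton 0, Set.singleton_nonempty 0, by simp, fun h => (hS h).elim⟩
  choose B hBf hBne hBker hBle using hB
  -- A base point in each shape: a tile `S t` contained in `F` then has `σ S * t ∈ F`, although `t`
  -- itself may lie outside `F`.
  have hσ : ∀ S : Finset Γ, ∃ s, S ∈ 𝒮 → s ∈ S := fun S => by
    by_cases hS : S ∈ 𝒮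
    · exact ⟨_, fun _ => (h𝒮 S hS).1.choose_spec⟩
    · exact ⟨1, fun h => (hS h).elim⟩
  choose σ hσ using hσ
  -- `D` depends on the shapes but not on `F`, so its averages converge to `mℓ(D) ≤ m`.
  set D : Set M := ∑ S ∈ 𝒮, insert 0 (groupAction R M (σ S) '' B S) with hD
  have hDf : D.Finite := Set.finite_finsetSum fun S _ => ((hBf S).image _).insert 0
  have hD0 : 0 ∈ D := Set.zero_mem_finsetSum fun S _ => Set.mem_insert _ _
  have hDker : D ⊆ LinearMap.ker φ := by
    refine Set.finsetSum_subset_coe (LinearMap.ker φ) fun S _ => ?_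
    refine Set.insert_subset (zero_mem _) ?_
    rintro _ ⟨x, hx, rfl⟩
    exact Submodule.smul_mem _ _ (hBker S hx)
  have hkey : ∀ᶠ F in invariantFilter Γ,
      ℓ.average Γ A F ≤ c + ENNReal.ofReal ε * (c + ℓ.length A) + ℓ.average Γ D F := by
    filter_upwards [hev, eventually_nonempty_invariantFilter] with F ⟨T, E, hT, hcov, hs, hE⟩ hF
    set X : Set M := ∑ q ∈ T, groupAction R M q.2⁻¹ '' B q.1 with hX
    have hXf : X.Finite := Set.finite_finsetSum fun q _ => (hBf _).image _
    have hXne : X.Nonempty := Set.nonempty_finsetSum fun q _ => (hBne _).image _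
    have hAne : (bracketSum R A F).Nonempty := ⟨0, zero_mem_bracketSum h0 F⟩
    have hXD : X ⊆ bracketSum R D F := sum_image_subset_bracketSum
      (fun q hq => ⟨(hT q hq).1, (hT q hq).2 _ (hσ _ (hT q hq).1)⟩) B
    have htri := hb.triangle M (bracketSum R A F) X {0} (finite_bracketSum hA F) hAne hXf hXne
      (Set.finite_singleton 0) (Set.singleton_nonempty 0)
    rw [hb.upgrading M _ hAne, hb.upgrading M _ hXne] at htri
    have htile : ∑ q ∈ T, b.length (bracketSum R A q.1) (B q.1) + E.card * ℓ.length A ≤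
        (c + ENNReal.ofReal ε * (c + ℓ.length A)) * F.card :=
      ENNReal.sum_tiles_le (g := fun S => b.length (bracketSum R A S) (B S)) hε
        (fun q hq => hBle _ (hT q hq).1) hs hE
    rw [average_le_iff hF, add_mul, ← length_bracketSum_eq hF]
    exact htri.trans (add_le_add
      ((BivariantWeakLength.length_bracketSum_le_of_cover hb.upgrading h0 hcov hBne).trans htile)
      (ℓ.mono hXne hXD))
  calc ℓ.meanSet Γ A
      ≤ c + ENNReal.ofReal ε * (c + ℓ.length A) + ℓ.meanSet Γ D :=
        le_of_tendsto_of_tendsto (tendsto_average_meanSet hΓ hfin hA h0)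
          (tendsto_const_nhds.add (tendsto_average_meanSet hΓ hfin hDf hD0)) hkey
    _ ≤ c + ENNReal.ofReal ε * (c + ℓ.length A) + m := by gcongr; exact hm D hDf hD0 hDker
    _ = c + m + ENNReal.ofReal ε * (c + ℓ.length A) := add_right_comm _ _ _

/-- The addition formula for the mean weak length. -/
theorem mean_eq_mean_submodule_add_mean_quotient {b : BivariantWeakLength.{u, v} R}
    (hΓ : IsAmenableGroup Γ) (hfin : ℓ.LocallyFinite) (hquot : ℓ.StrongQuotient)
    (hb : b.IsProperUpgrading ℓ) (M₁ : Submodule (MonoidAlgebra R Γ) M) :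
    ℓ.mean Γ M = ℓ.mean Γ M₁ + ℓ.mean Γ (M ⧸ M₁) := by
  classical
  refine le_antisymm (iSup₂_le fun A hA => ?_) ?_
  · rw [add_comm]
    refine (meanSet_le_meanSet_image_add hΓ hfin hb M₁.mkQ A.finite_toSet hA
      (m := ℓ.mean Γ M₁) fun B hB hB0 hker => ?_).trans ?_
    · rw [Submodule.ker_mkQ] at hker
      have hpre : M₁.subtype '' (M₁.subtype ⁻¹' B) = B :=
        Set.image_preimage_eq_of_subset (by simpa using hker)
      have hfinB : (M₁.subtype ⁻¹' B).Finite := hB.preimage M₁.subtype_injective.injOn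
      have h0B : 0 ∈ M₁.subtype ⁻¹' B := by simpa using hB0
      rw [← hpre, meanSet_image_of_injective hb M₁.subtype M₁.subtype_injective hfinB h0B]
      exact meanSet_le_mean hfinB h0B
    · gcongr
      exact meanSet_le_mean (A.finite_toSet.image _) ⟨0, hA, map_zero _⟩
  · refine ENNReal.biSup_add_biSup_le' ⟨{0}, by simp⟩ ⟨{0}, by simp⟩ fun B hB A' hA' => ?_
    obtain ⟨g, hg⟩ := M₁.mkQ_surjective.hasRightInverse
    -- The section `g` need not send `0` to `0`; inserting `0` leaves the image `A'` unchanged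
    -- because `0 ∈ A'`.
    set A : Set M := insert 0 (g '' A') with hAdef
    have hAf : A.Finite := (A'.finite_toSet.image g).insert 0
    have hA0 : 0 ∈ A := Set.mem_insert _ _
    have himg : M₁.mkQ '' A = A' := by
      rw [hAdef, Set.image_insert_eq, map_zero, hg.image_image, Set.insert_eq_of_mem]
      exact hA'
    have h := meanSet_image_add_meanSet_le hΓ hfin hquot M₁.mkQ hAf hA0
      (B.finite_toSet.image M₁.subtype) ⟨0, hB, map_zero _⟩ (by
        rintro _ ⟨x, -, rfl⟩
        simp)
    rw [himg, meanSet_image_of_injective hb M₁.subtype M₁.subtype_injective B.finite_toSet hB,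
      add_comm] at h
    exact h.trans (meanSet_le_mean (hAf.add (B.finite_toSet.image _))
      ⟨0, hA0, 0, ⟨0, hB, map_zero _⟩, add_zero 0⟩)

end WeakLength

/-- The first conjunct says that the limits defining the mean weak length exist and are finite, the
second is the addition formula. -/
theorem theorem1p2 {R : Type u} [Ring R] {Γ : Type w} [Group Γ] (hΓ : IsAmenableGroup Γ)
    (ℓ : WeakLength.{u, v} R) (hfin : ℓ.LocallyFinite) (hquot : ℓ.StrongQuotient)
    (hup : ∃ b : BivariantWeakLength.{u, v} R, b.IsProperUpgrading ℓ) :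
    (∀ (M : Type v) [AddCommGroup M] [Module R M] [Module (MonoidAlgebra R Γ) M]
        [IsScalarTower R (MonoidAlgebra R Γ) M] (A : Set M), A.Finite → 0 ∈ A →
        ∃ c : ℝ≥0, Tendsto (ℓ.average Γ A) (invariantFilter Γ) (𝓝 (c : ℝ≥0∞))) ∧
      ∀ (M₂ : Type v) [AddCommGroup M₂] [Module R M₂] [Module (MonoidAlgebra R Γ) M₂]
        [IsScalarTower R (MonoidAlgebra R Γ) M₂] (M₁ : Submodule (MonoidAlgebra R Γ) M₂),
        ℓ.mean Γ M₂ = ℓ.mean Γ M₁ + ℓ.mean Γ (M₂ ⧸ M₁) :=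
  let ⟨_, hb⟩ := hup
  ⟨fun _ _ _ _ _ _ hA h0 => WeakLength.exists_tendsto_average hΓ hfin hA h0,
    fun _ _ _ _ _ M₁ => WeakLength.mean_eq_mean_submodule_add_mean_quotient hΓ hfin hquot hb M₁⟩
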